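/- **Setting.** For $k\ge 1$ let two parties hold $k$ qubits each, let $|\Phi\rangle=(|00\rangle+|11\rangle)/\sqrt2$, $\Phi=|\Phi\rangle\langle\Phi|$, and regard $\Phi^{\otimes k}$ as a bipartite state on $(\mathbb C^2)^{\otimes k}\otimes(\mathbb C^2)^{\otimes k}$. For $\alpha\in[0,1]$ the isotropic state is $$\rho^I_\alpha(k)=(1-\alpha)\,\Phi^{\otimes k}+\alpha\,\frac{I-\Phi^{\otimes k}}{2^{2k}-1}.$$ For $\varepsilon\in[0,1]$, a bipartite state $\rho$, and a set $\mathcal O$ of channels (completely positive trace-preserving maps) from the system of $\rho$ to that of $\Phi^{\otimes m}$, the virtual distillation overhead is $$C^\varepsilon(\rho,m)=\inf\Big\{\lambda_++\lambda_-\;\Big|\;\tfrac12\big\|\Phi^{\otimes m}-(\lambda_+\Lambda_+(\rho)-\lambda_-\Lambda_-(\rho))\big\|_1\le\varepsilon,\ \lambda_\pm\ge0,\ \lambda_+-\lambda_-=1,\ \Lambda_\pm\in\mathcal O\Big\},$$ with $\inf\emptyset=\infty$. A separable state is a convex combination of product states. A channel is separability-preserving (PPT-preserving) if it maps every separable state to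 a separable state (every state with positive partial transpose to a state with positive partial transpose). A separable operation is a channel with Kraus operators of the form $A_i\otimes B_i$. **Proposition (isotropic states).** Let $k\ge1$, $\alpha\in[0,1]$, $\varepsilon\in[0,1]$. 1. Let $1\le m\le k$ and let $\mathcal O$ be any set of channels, each of which is separability-preserving or PPT-preserving, that includes all separable operations. Then, with $c=(2^k-2^{k-m})/(2^k-1)$, $$C^\varepsilon(\rho^I_\alpha(k),m)=\begin{cases}\max\{2^{m+1}(1-\varepsilon)-1,\,1\}&\alpha\ge1-2^{-k},\\[2pt] \max\Big\{\dfrac{2(1-\varepsilon)}{1-\alpha c}-1,\,1\Big\}&\alpha\le1-2^{-k}.\end{cases}$$ 2. In particular, for $m=k$ and such $\mathcal O$, $$C^\varepsilon(\rho^I_\alpha(k),k)=\begin{cases}\max\{2^{k+1}(1-\varepsilon)-1,\,1\}&\alpha\ge1-2^{-k},\\[2pt] \max\Big\{\dfrac{1+\alpha-2\varepsilon}{1-\alpha},\,1\Big\}&\alpha\le1-2^{-k}.\end{cases}$$ 3. The formula in 2 also holds for every set $\mathcal O$ of channels, each separability-preserving or PPT-preserving, that contains all local unitary operations assisted by shared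 classical randomness, $X\mapsto\sum_ip_i(U_i\otimes V_i)X(U_i\otimes V_i)^\dagger$, and the preparation $X\mapsto\operatorname{tr}(X)\,\sigma$ of every separable state $\sigma$. In particular it holds for LOCC, the set of channels implemented by finitely many rounds of local quantum operations and classical communication. -/

import Mathlib

open scoped Kronecker ComplexOrder MatrixOrder

noncomputable section

namespace VirtualDistillation

/-- Linear maps from operators on `ℂ^n` to operators on `ℂ^m`. -/
abbrev SuperOp (n m : Type*) : Type _ := Matrix n n ℂ →ₗ[ℂ] Matrix m m ℂ

/-- The computational basis labels of `k` qubits. -/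
abbrev Qubits (k : ℕ) : Type := Fin k → Fin 2

section General

variable {n m : Type*} [Fintype n] [DecidableEq n] [Fintype m] [DecidableEq m]

/-- Density matrices. -/
def IsState (ρ : Matrix n n ℂ) : Prop := ρ.PosSemidef ∧ ρ.trace = 1

/-- The trace norm `‖X‖₁ = tr √(X† X)`. -/
def traceNorm (X : Matrix n n ℂ) : ℝ := (CFC.sqrt (X.conjTranspose * X)).trace.re

/-- The map `id_d ⊗ Λ`: the matrix `X` on `ℂ^d ⊗ ℂ^n` is read as a `d × d` block matrix whose
blocks are operators on `ℂ^n`, and `Λ` is applied to every block. -/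
def amplify (d : ℕ) (Λ : SuperOp n m) (X : Matrix (Fin d × n) (Fin d × n) ℂ) :
    Matrix (Fin d × m) (Fin d × m) ℂ :=
  Matrix.of fun p q => Λ (Matrix.of fun i j => X (p.1, i) (q.1, j)) p.2 q.2

/-- Quantum channels: completely positive and trace-preserving linear maps. -/
def IsChannel (Λ : SuperOp n m) : Prop :=
  (∀ (d : ℕ) (X : Matrix (Fin d × n) (Fin d × n) ℂ),
      X.PosSemidef → (amplify d Λ X).PosSemidef) ∧
    ∀ X : Matrix n n ℂ, (Λ X).trace = X.trace

/-- The map `X ↦ K X K†`. -/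
def sandwich (K : Matrix m n ℂ) : SuperOp n m where
  toFun X := K * X * K.conjTranspose
  map_add' X Y := by rw [Matrix.mul_add, Matrix.add_mul]
  map_smul' c X := by simp

end General

section Bipartite

variable {a b c d : Type} [Fintype a] [DecidableEq a] [Fintype b] [DecidableEq b]
  [Fintype c] [DecidableEq c] [Fintype d] [DecidableEq d]

/-- Separable states: convex combinations of product states. -/
def separableStates (a b : Type) [Fintype a] [DecidableEq a] [Fintype b] [DecidableEq b] :
    Set (Matrix (a × b) (a × b) ℂ) :=
  convexHull ℝ {ρ | ∃ (σ : Matrix a a ℂ) (τ : Matrix b b ℂ), IsState σ ∧ IsState τ ∧ ρ = σ ⊗ₖ τ}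

/-- Partial transposition on the second tensor factor. -/
def partialTranspose (X : Matrix (a × b) (a × b) ℂ) : Matrix (a × b) (a × b) ℂ :=
  Matrix.of fun p q => X (p.1, q.2) (q.1, p.2)

/-- States with positive partial transpose. -/
def pptStates (a b : Type) [Fintype a] [DecidableEq a] [Fintype b] [DecidableEq b] :
    Set (Matrix (a × b) (a × b) ℂ) :=
  {ρ | IsState ρ ∧ (partialTranspose ρ).PosSemidef}

/-- Separability-preserving (non-entangling) operations. -/
def IsSeparabilityPreserving (Λ : SuperOp (a × b) (c × d)) : Prop :=
  IsChannel Λ ∧ ∀ σ ∈ separableStates a b, Λ σ ∈ separableStates c d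

/-- PPT-preserving operations. -/
def IsPPTPreserving (Λ : SuperOp (a × b) (c × d)) : Prop :=
  IsChannel Λ ∧ ∀ σ ∈ pptStates a b, Λ σ ∈ pptStates c d

/-- Separable operations: channels with product Kraus operators `A_i ⊗ B_i`. -/
def IsSeparableOperation (Λ : SuperOp (a × b) (c × d)) : Prop :=
  IsChannel Λ ∧ ∃ (r : ℕ) (A : Fin r → Matrix c a ℂ) (B : Fin r → Matrix d b ℂ),
    Λ = ∑ i, sandwich (A i ⊗ₖ B i)

/-- Local unitary operations assisted by shared classical randomness: with probability `p i` the
two parties apply the local unitaries `U i` and `V i`. -/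
def IsRandomLocalUnitary (Λ : SuperOp (a × b) (a × b)) : Prop :=
  ∃ (r : ℕ) (p : Fin r → ℝ) (U : Fin r → Matrix a a ℂ) (V : Fin r → Matrix b b ℂ),
    (∀ i, 0 ≤ p i) ∧ ∑ i, p i = 1 ∧
    (∀ i, U i ∈ Matrix.unitaryGroup a ℂ) ∧ (∀ i, V i ∈ Matrix.unitaryGroup b ℂ) ∧
    Λ = ∑ i, (p i : ℂ) • sandwich (U i ⊗ₖ V i)

/-- Preparation of a separable state: the input is discarded and a fixed separable state `σ` is
output, `X ↦ tr(X) σ`. -/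
def IsSeparablePreparation (Λ : SuperOp (a × b) (c × d)) : Prop :=
  ∃ σ ∈ separableStates c d, ∀ X, Λ X = X.trace • σ

/-- (Finite-round) LOCC channels to the output system `c : d`. A protocol either stops, or one
party performs a local instrument and announces the outcome `i`, whereupon the parties proceed with
an LOCC protocol that may depend on `i`. The outcomes are taken to be fine-grained, with one Kraus
operator `K i` each, and the local output system `a' i` may depend on the outcome; a local channel,
or a coarser instrument, is the case where the continuation ignores (part of) the outcome. -/
inductive IsLOCC {c d : Type} [Fintype c] [DecidableEq c] [Fintype d] [DecidableEq d] :
    ∀ {a b : Type} [Fintype a] [DecidableEq a] [Fintype b] [DecidableEq b],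
      SuperOp (a × b) (c × d) → Prop
  | done : IsLOCC (LinearMap.id : SuperOp (c × d) (c × d))
  | alice {a b : Type} [Fintype a] [DecidableEq a] [Fintype b] [DecidableEq b]
      (r : ℕ) (a' : Fin r → Type) [∀ i, Fintype (a' i)] [∀ i, DecidableEq (a' i)]
      (K : ∀ i, Matrix (a' i) a ℂ) (hK : ∑ i, (K i).conjTranspose * K i = 1)
      (Λ : ∀ i, SuperOp (a' i × b) (c × d)) (hΛ : ∀ i, IsLOCC (Λ i)) :
      IsLOCC (∑ i, Λ i ∘ₗ sandwich (K i ⊗ₖ (1 : Matrix b b ℂ)))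
  | bob {a b : Type} [Fintype a] [DecidableEq a] [Fintype b] [DecidableEq b]
      (r : ℕ) (b' : Fin r → Type) [∀ i, Fintype (b' i)] [∀ i, DecidableEq (b' i)]
      (K : ∀ i, Matrix (b' i) b ℂ) (hK : ∑ i, (K i).conjTranspose * K i = 1)
      (Λ : ∀ i, SuperOp (a × b' i) (c × d)) (hΛ : ∀ i, IsLOCC (Λ i)) :
      IsLOCC (∑ i, Λ i ∘ₗ sandwich ((1 : Matrix a a ℂ) ⊗ₖ K i))

end Bipartite

/-- The two-qubit vector `(|00⟩ + |11⟩)/√2`. -/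
def bellVec : Fin 2 × Fin 2 → ℂ := fun p => if p.1 = p.2 then ((1 / √2 : ℝ) : ℂ) else 0

/-- The Bell state `Φ = |Φ⟩⟨Φ|`. -/
def bellState : Matrix (Fin 2 × Fin 2) (Fin 2 × Fin 2) ℂ :=
  Matrix.vecMulVec bellVec (star bellVec)

/-- `Φ^{⊗k}`, with the `k` first qubits grouped into the first party's system and the `k` second
qubits grouped into the second party's system. -/
def bellPow (k : ℕ) : Matrix (Qubits k × Qubits k) (Qubits k × Qubits k) ℂ :=
  Matrix.of fun p q => ∏ i, bellState (p.1 i, p.2 i) (q.1 i, q.2 i)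

/-- The isotropic state `(1 - α) Φ^{⊗k} + α (I - Φ^{⊗k}) / (2^{2k} - 1)`. -/
def isotropicState (k : ℕ) (α : ℝ) : Matrix (Qubits k × Qubits k) (Qubits k × Qubits k) ℂ :=
  (1 - α) • bellPow k + (α / (2 ^ (2 * k) - 1)) • (1 - bellPow k)

/-- The virtual resource distillation overhead `C^ε(ρ, m)` with respect to the set `O` of free
operations and the target `Φ^{⊗m}`; it is `⊤` if there is no feasible decomposition. -/
def overhead {n : Type} [Fintype n] [DecidableEq n] {m : ℕ}
    (O : Set (SuperOp n (Qubits m × Qubits m))) (ε : ℝ) (ρ : Matrix n n ℂ) : EReal :=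
  sInf {x | ∃ (lp lm : ℝ) (Λp Λm : SuperOp n (Qubits m × Qubits m)),
    0 ≤ lp ∧ 0 ≤ lm ∧ lp - lm = 1 ∧ Λp ∈ O ∧ Λm ∈ O ∧
    1 / 2 * traceNorm (bellPow m - (lp • Λp ρ - lm • Λm ρ)) ≤ ε ∧
    x = ((lp + lm : ℝ) : EReal)}

end VirtualDistillation

end

namespace VirtualDistillation

open Matrix

/-! ### Trace norm of Hermitian matrices. -/

section TraceNorm

variable {n : Type*} [Fintype n] [DecidableEq n]

/-! Everything reduces to one number: the largest fidelity `F` with the target Φ that a free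
operation can reach from the given state. Testing a feasible decomposition against the projection Φ
gives 1 - ε ≤ λ₊ F, because the subtracted term has nonnegative fidelity; since λ₊ + λ₋ = 2λ₊ - 1,
this bounds the cost from below (`one_sub_le_mul_of_feasible`). Conversely, suppose free operations
can output the isotropic state of fidelity `F` and the one of fidelity 0. Their affine combinations
stay on the isotropic line, where the trace distance to Φ is simply the parameter, so λ₊ = max((1 -
ε)/F, 1) is feasible (`overhead_eq_of_fidelity`).

It remains to find `F`. Write D = 2^k and d = 2^m. A PPT state on ℂ^d ⊗ ℂ^d has fidelity at most 1/d
(`re_trace_maxEnt_mul_le`), and the isotropic state is separable for α ≥ 1 - 1/D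
(`isotropic_mem_separableStates`, by an explicit decomposition into product vectors). In that regime
F = 1/d, attained by a fixed preparation. Below the threshold the isotropic state is a mixture of Φ
and the threshold separable state; fidelity is linear, so F ≤ 1 - αc (`fidelity_isotropic_le`). An
LOCC protocol attains this bound: measure the last k - m qubit pairs, keep the others if the
outcomes agree, and otherwise prepare the threshold separable state (`collapse_isotropic`). For m =
k the identity suffices. -/

lemma re_trace_mul_nonneg {A B : Matrix n n ℂ} (hA : A.PosSemidef) (hB : B.PosSemidef) :
    0 ≤ (A * B).trace.re := by
  obtain ⟨C, rfl⟩ := CStarAlgebra.nonneg_iff_eq_star_mul_self.mp hA.nonneg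
  rw [star_eq_conjTranspose, Matrix.mul_assoc, Matrix.trace_mul_comm]
  exact (Complex.nonneg_iff.mp (hB.mul_mul_conjTranspose_same C).trace_nonneg).1

/-- A projection detects at most half of the trace norm of a traceless Hermitian matrix. -/
lemma re_trace_mul_le_traceNorm {P X : Matrix n n ℂ} (hP : P.PosSemidef)
    (hP' : (1 - P).PosSemidef) (hX : X.IsHermitian) (h0 : X.trace = 0) :
    (P * X).trace.re ≤ 1 / 2 * traceNorm X := by
  have hs : IsSelfAdjoint X := hX
  have habs : traceNorm X = (CFC.abs X).trace.re := rfl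
  have h1 := CFC.posPart_add_negPart X hs
  have h2 := CFC.posPart_sub_negPart X hs
  have hp : (X⁺).PosSemidef := Matrix.nonneg_iff_posSemidef.mp (CFC.posPart_nonneg X)
  have hn : (X⁻).PosSemidef := Matrix.nonneg_iff_posSemidef.mp (CFC.negPart_nonneg X)
  have e1 : (X⁺).trace.re + (X⁻).trace.re = traceNorm X := by
    rw [habs, ← h1, Matrix.trace_add, Complex.add_re]
  have e2 : (X⁺).trace.re - (X⁻).trace.re = 0 := by
    rw [← Complex.sub_re, ← Matrix.trace_sub, h2, h0, Complex.zero_re]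
  have e3 : (P * X).trace.re = (P * X⁺).trace.re - (P * X⁻).trace.re := by
    rw [← Complex.sub_re, ← Matrix.trace_sub, ← Matrix.mul_sub, h2]
  -- Positivity of `P` discards tr(P X⁻), and positivity of `1 - P` gives tr(P X⁺) ≤ tr X⁺. As `X`
  -- is traceless, tr X⁺ is half the trace norm.
  have e4 := re_trace_mul_nonneg hP hn
  have e5 := re_trace_mul_nonneg hP' hp
  rw [Matrix.sub_mul, Matrix.one_mul, Matrix.trace_sub, Complex.sub_re] at e5
  linarith

lemma traceNorm_sub_of_mul_eq_zero {A B : Matrix n n ℂ} (hA : A.PosSemidef) (hB : B.PosSemidef)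
    (h : A * B = 0) (h' : B * A = 0) : traceNorm (A - B) = (A + B).trace.re := by
  have : CFC.sqrt ((A - B)ᴴ * (A - B)) = A + B := by
    refine CFC.sqrt_unique ?_ (hA.add hB).nonneg
    rw [(hA.isHermitian.sub hB.isHermitian).eq]
    simp only [Matrix.mul_add, Matrix.add_mul, Matrix.mul_sub, Matrix.sub_mul, h, h']
    abel
  rw [traceNorm, this]

lemma traceNorm_neg (X : Matrix n n ℂ) : traceNorm (-X) = traceNorm X := by
  simp [traceNorm]

end TraceNorm

/-! ### Maximally entangled and isotropic states in arbitrary dimension. -/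

section MaxEnt

lemma card_sq_sub_one_pos {n : Type*} [Fintype n] [Nontrivial n] : (0 : ℝ) < (Fintype.card n : ℝ) ^ 2 - 1 := by
  have : (1 : ℝ) < Fintype.card n := by exact_mod_cast Fintype.one_lt_card
  nlinarith

variable (n : Type*) [Fintype n] [DecidableEq n]

/-- The maximally entangled state on `ℂ^n ⊗ ℂ^n`. -/
noncomputable def maxEnt : Matrix (n × n) (n × n) ℂ :=
  Matrix.of fun p q => if p.1 = p.2 ∧ q.1 = q.2 then (Fintype.card n : ℂ)⁻¹ else 0

variable {n}

lemma maxEnt_apply (p q : n × n) :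
    maxEnt n p q = if p.1 = p.2 ∧ q.1 = q.2 then (Fintype.card n : ℂ)⁻¹ else 0 := rfl

lemma maxEnt_isHermitian : (maxEnt n).IsHermitian := by
  ext p q
  simp only [conjTranspose_apply, maxEnt_apply, and_comm]
  split_ifs <;> simp

lemma trace_maxEnt_mul (X : Matrix (n × n) (n × n) ℂ) :
    (maxEnt n * X).trace = (Fintype.card n : ℂ)⁻¹ * ∑ i, ∑ j, X (i, i) (j, j) := by
  simp only [Matrix.trace, Matrix.diag, Matrix.mul_apply, maxEnt_apply, Fintype.sum_prod_type,
    ite_and, ite_mul, zero_mul, Finset.mul_sum]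
  rw [Finset.sum_comm]
  simp only [Finset.sum_ite_eq', Finset.mem_univ, if_true, Finset.sum_ite_irrel,
    Finset.sum_const_zero, Finset.sum_ite_eq]
  rw [Finset.sum_comm]

variable [Nonempty n]

lemma trace_maxEnt : (maxEnt n).trace = 1 := by
  have : (Fintype.card n : ℂ) ≠ 0 := by exact_mod_cast Fintype.card_ne_zero
  simp [Matrix.trace, maxEnt_apply, Fintype.sum_prod_type, this]

lemma maxEnt_mul_self : maxEnt n * maxEnt n = maxEnt n := by
  have : (Fintype.card n : ℂ) ≠ 0 := by exact_mod_cast Fintype.card_ne_zero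
  ext p q
  simp only [Matrix.mul_apply, maxEnt_apply, Fintype.sum_prod_type, ite_and]
  by_cases h1 : p.1 = p.2 <;> by_cases h2 : q.1 = q.2 <;> simp [h1, h2, this]

lemma maxEnt_posSemidef : (maxEnt n).PosSemidef := by
  have h := Matrix.posSemidef_conjTranspose_mul_self (maxEnt n)
  rwa [maxEnt_isHermitian.eq, maxEnt_mul_self] at h

lemma one_sub_maxEnt_posSemidef : (1 - maxEnt n).PosSemidef := by
  have h := Matrix.posSemidef_conjTranspose_mul_self (1 - maxEnt n)
  rw [(Matrix.isHermitian_one.sub maxEnt_isHermitian).eq] at h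
  convert h using 1
  simp [Matrix.mul_sub, Matrix.sub_mul, maxEnt_mul_self]

lemma maxEnt_isState : IsState (maxEnt n) := ⟨maxEnt_posSemidef, trace_maxEnt⟩

variable (n) in
/-- The isotropic state on `ℂ^n ⊗ ℂ^n`. -/
noncomputable def isotropic (α : ℝ) : Matrix (n × n) (n × n) ℂ :=
  (1 - α) • maxEnt n + (α / ((Fintype.card n : ℝ) ^ 2 - 1)) • (1 - maxEnt n)

lemma trace_one_sub_maxEnt :
    (1 - maxEnt n).trace = (((Fintype.card n : ℝ) ^ 2 - 1 : ℝ) : ℂ) := by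
  rw [Matrix.trace_sub, trace_maxEnt, Matrix.trace_one, Fintype.card_prod]
  push_cast; ring

lemma isotropic_isState [Nontrivial n] {α : ℝ} (h0 : 0 ≤ α) (h1 : α ≤ 1) :
    IsState (isotropic n α) := by
  have hD := card_sq_sub_one_pos (n := n)
  refine ⟨(maxEnt_posSemidef.smul (sub_nonneg.mpr h1)).add
    (one_sub_maxEnt_posSemidef.smul (div_nonneg h0 hD.le)), ?_⟩
  rw [isotropic, Matrix.trace_add, Matrix.trace_smul, Matrix.trace_smul, trace_maxEnt,
    trace_one_sub_maxEnt, Complex.real_smul, Complex.real_smul, ← Complex.ofReal_mul,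
    div_mul_cancel₀ _ hD.ne']
  simp

/-- The difference is `t` times Φ minus the normalised complementary projection, two orthogonal
operators of trace one. No range is imposed on `t`, so virtual combinations that are not states are
covered. -/
lemma traceNorm_maxEnt_sub_isotropic [Nontrivial n] (t : ℝ) :
    traceNorm (maxEnt n - isotropic n t) = 2 * |t| := by
  have hD := card_sq_sub_one_pos (n := n)
  have key : ∀ t : ℝ, 0 ≤ t → traceNorm (t • maxEnt n -
      (t / ((Fintype.card n : ℝ) ^ 2 - 1)) • (1 - maxEnt n)) = 2 * t := by
    intro t ht
    rw [traceNorm_sub_of_mul_eq_zero (maxEnt_posSemidef.smul ht)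
      (one_sub_maxEnt_posSemidef.smul (div_nonneg ht hD.le))]
    · rw [Matrix.trace_add, Matrix.trace_smul, Matrix.trace_smul, trace_maxEnt,
        trace_one_sub_maxEnt, Complex.real_smul, Complex.real_smul, ← Complex.ofReal_mul,
        div_mul_cancel₀ _ hD.ne']
      simp; ring
    · simp [Matrix.mul_sub, maxEnt_mul_self]
    · simp [Matrix.sub_mul, maxEnt_mul_self]
  have e : maxEnt n - isotropic n t = t • maxEnt n -
      (t / ((Fintype.card n : ℝ) ^ 2 - 1)) • (1 - maxEnt n) := by
    rw [isotropic, sub_smul, one_smul]; abel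
  rcases le_total 0 t with ht | ht
  · rw [e, key t ht, abs_of_nonneg ht]
  · rw [e, ← traceNorm_neg, abs_of_nonpos ht, ← key (-t) (neg_nonneg.mpr ht)]
    congr 1
    rw [neg_div, neg_smul, neg_smul]; abel

end MaxEnt

/-! ### Translation from qubits to the general picture. -/

section Qubits

lemma bellPow_eq_maxEnt (k : ℕ) : bellPow k = maxEnt (Qubits k) := by
  have hs : ((√2 : ℝ) : ℂ)⁻¹ * ((√2 : ℝ) : ℂ)⁻¹ = 2⁻¹ := by
    rw [← mul_inv, ← Complex.ofReal_mul, Real.mul_self_sqrt (by norm_num)]; norm_num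
  ext p q
  have h : ∀ i, bellState (p.1 i, p.2 i) (q.1 i, q.2 i) =
      if p.1 i = p.2 i ∧ q.1 i = q.2 i then (2 : ℂ)⁻¹ else 0 := by
    intro i
    simp only [bellState, Matrix.vecMulVec_apply, bellVec, Pi.star_apply]
    by_cases h1 : p.1 i = p.2 i <;> by_cases h2 : q.1 i = q.2 i <;> simp [h1, h2, hs]
  simp only [bellPow, Matrix.of_apply, h, maxEnt_apply]
  by_cases hc : p.1 = p.2 ∧ q.1 = q.2
  · rw [if_pos hc]
    simp [hc.1, hc.2]
  · rw [if_neg hc]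
    rw [not_and_or] at hc
    rcases hc with hc | hc
    · obtain ⟨i, hi⟩ := Function.ne_iff.mp hc
      exact Finset.prod_eq_zero (Finset.mem_univ i) (by simp [hi])
    · obtain ⟨i, hi⟩ := Function.ne_iff.mp hc
      exact Finset.prod_eq_zero (Finset.mem_univ i) (by simp [hi])

lemma card_qubits (k : ℕ) : Fintype.card (Qubits k) = 2 ^ k := by simp

lemma isotropicState_eq (k : ℕ) (α : ℝ) : isotropicState k α = isotropic (Qubits k) α := by
  rw [isotropicState, isotropic, bellPow_eq_maxEnt, card_qubits, pow_mul']
  push_cast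
  rfl

end Qubits


/-! ### The cone of unnormalised separable operators. -/

section SeparableCone

variable {a b c d : Type} [Fintype a] [DecidableEq a] [Fintype b] [DecidableEq b]
  [Fintype c] [DecidableEq c] [Fintype d] [DecidableEq d]

/-- Sums of tensor products of positive semidefinite matrices. -/
def separableCone (a b : Type) : AddSubmonoid (Matrix (a × b) (a × b) ℂ) :=
  AddSubmonoid.closure
    {X | ∃ (A : Matrix a a ℂ) (B : Matrix b b ℂ), A.PosSemidef ∧ B.PosSemidef ∧ X = A ⊗ₖ B}

omit [Fintype a] [DecidableEq a] [Fintype b] [DecidableEq b] in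
lemma kronecker_mem_separableCone {A : Matrix a a ℂ} {B : Matrix b b ℂ} (hA : A.PosSemidef)
    (hB : B.PosSemidef) : A ⊗ₖ B ∈ separableCone a b :=
  AddSubmonoid.subset_closure ⟨A, B, hA, hB, rfl⟩

omit [Fintype a] [DecidableEq a] [Fintype b] [DecidableEq b] in
lemma smul_mem_separableCone {X : Matrix (a × b) (a × b) ℂ} (hX : X ∈ separableCone a b)
    {r : ℝ} (hr : 0 ≤ r) : r • X ∈ separableCone a b := by
  induction hX using AddSubmonoid.closure_induction with
  | mem x hx =>
    obtain ⟨A, B, hA, hB, rfl⟩ := hx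
    rw [← Matrix.smul_kronecker]
    exact kronecker_mem_separableCone (hA.smul hr) hB
  | zero => rw [smul_zero]; exact zero_mem _
  | add x y _ _ hx hy => rw [smul_add]; exact add_mem hx hy

omit [DecidableEq a] [DecidableEq b] [DecidableEq c] [DecidableEq d] in
lemma sandwich_mem_separableCone {X : Matrix (a × b) (a × b) ℂ} (hX : X ∈ separableCone a b)
    (A : Matrix c a ℂ) (B : Matrix d b ℂ) : sandwich (A ⊗ₖ B) X ∈ separableCone c d := by
  induction hX using AddSubmonoid.closure_induction with
  | mem x hx =>
    obtain ⟨S, T, hS, hT, rfl⟩ := hx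
    have : sandwich (A ⊗ₖ B) (S ⊗ₖ T) = (A * S * Aᴴ) ⊗ₖ (B * T * Bᴴ) := by
      simp only [sandwich, LinearMap.coe_mk, AddHom.coe_mk]
      rw [Matrix.conjTranspose_kronecker, Matrix.mul_kronecker_mul, Matrix.mul_kronecker_mul]
    rw [this]
    exact kronecker_mem_separableCone (hS.mul_mul_conjTranspose_same A)
      (hT.mul_mul_conjTranspose_same B)
  | zero => rw [map_zero]; exact zero_mem _
  | add x y _ _ hx hy => rw [map_add]; exact add_mem hx hy

lemma separableStates_subset_separableCone :
    separableStates a b ⊆ (separableCone a b : Set (Matrix (a × b) (a × b) ℂ)) := by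
  refine convexHull_min ?_ ?_
  · rintro _ ⟨σ, τ, hσ, hτ, rfl⟩
    exact kronecker_mem_separableCone hσ.1 hτ.1
  · intro x hx y hy s t hs ht _
    exact add_mem (smul_mem_separableCone hx hs) (smul_mem_separableCone hy ht)

lemma kronecker_eq_zero_or_smul_separable {A : Matrix a a ℂ} {B : Matrix b b ℂ}
    (hA : A.PosSemidef) (hB : B.PosSemidef) :
    A ⊗ₖ B = 0 ∨ ∃ t : ℝ, 0 < t ∧ ∃ σ ∈ separableStates a b, A ⊗ₖ B = t • σ := by
  have aux : ∀ {n : Type} [Fintype n] [DecidableEq n] {M : Matrix n n ℂ}, M.PosSemidef →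
      M ≠ 0 → ∃ t : ℝ, 0 < t ∧ IsState (t⁻¹ • M) := by
    intro n _ _ M hM h0
    have ht := Complex.nonneg_iff.mp hM.trace_nonneg
    have hne : M.trace ≠ 0 := fun h => h0 (hM.trace_eq_zero_iff.mp h)
    have htr : M.trace = (M.trace.re : ℂ) := Complex.ext rfl (by simp [← ht.2])
    have hpos : 0 < M.trace.re := by
      refine lt_of_le_of_ne ht.1 fun h => hne ?_
      rw [htr, ← h, Complex.ofReal_zero]
    refine ⟨M.trace.re, hpos, hM.smul (inv_nonneg.mpr hpos.le), ?_⟩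
    rw [Matrix.trace_smul, htr, Complex.ofReal_re, Complex.real_smul, ← Complex.ofReal_mul,
      inv_mul_cancel₀ hpos.ne', Complex.ofReal_one]
  by_cases hA0 : A = 0
  · left; simp [hA0]
  by_cases hB0 : B = 0
  · left; simp [hB0]
  right
  obtain ⟨s, hs, hsA⟩ := aux hA hA0
  obtain ⟨t, ht, htB⟩ := aux hB hB0
  refine ⟨s * t, mul_pos hs ht, _, subset_convexHull ℝ _ ⟨_, _, hsA, htB, rfl⟩, ?_⟩
  rw [Matrix.smul_kronecker, Matrix.kronecker_smul, smul_smul, smul_smul]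
  rw [show s * t * s⁻¹ * t⁻¹ = 1 by field_simp, one_smul]

/-- The cone lets separability be checked by adding terms without tracking weights; normalisation is
restored here. A sum of multiples `s` and `t` of separable states is `s + t` times their convex
combination, and zero is the only element that cannot be normalised. -/
lemma eq_zero_or_smul_separable {X : Matrix (a × b) (a × b) ℂ} (hX : X ∈ separableCone a b) :
    X = 0 ∨ ∃ t : ℝ, 0 < t ∧ ∃ σ ∈ separableStates a b, X = t • σ := by
  induction hX using AddSubmonoid.closure_induction with
  | mem x hx =>
    obtain ⟨A, B, hA, hB, rfl⟩ := hx
    exact kronecker_eq_zero_or_smul_separable hA hB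
  | zero => exact Or.inl rfl
  | add x y _ _ hx hy =>
    rcases hx with rfl | ⟨s, hs, σ, hσ, rfl⟩
    · rwa [zero_add]
    rcases hy with rfl | ⟨t, ht, τ, hτ, rfl⟩
    · rw [add_zero]; exact Or.inr ⟨s, hs, σ, hσ, rfl⟩
    have hst : 0 < s + t := add_pos hs ht
    refine Or.inr ⟨s + t, hst, (s / (s + t)) • σ + (t / (s + t)) • τ,
      (convex_convexHull ℝ _) hσ hτ (div_nonneg hs.le hst.le) (div_nonneg ht.le hst.le)
        (by field_simp), ?_⟩
    rw [smul_add, smul_smul, smul_smul, mul_div_cancel₀ _ hst.ne', mul_div_cancel₀ _ hst.ne']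

/-- Separable states have positive partial transpose. -/
lemma separableStates_subset_pptStates : separableStates a b ⊆ pptStates a b := by
  refine convexHull_min ?_ ?_
  · rintro _ ⟨σ, τ, hσ, hτ, rfl⟩
    refine ⟨⟨hσ.1.kronecker hτ.1, ?_⟩, ?_⟩
    · rw [Matrix.trace_kronecker, hσ.2, hτ.2, one_mul]
    · have : partialTranspose (σ ⊗ₖ τ) = σ ⊗ₖ τᵀ := by
        ext p q; simp [partialTranspose]
      rw [this]
      exact hσ.1.kronecker hτ.1.transpose
  · intro x hx y hy s t hs ht hst
    refine ⟨⟨(hx.1.1.smul hs).add (hy.1.1.smul ht), ?_⟩, ?_⟩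
    · rw [Matrix.trace_add, Matrix.trace_smul, Matrix.trace_smul, hx.1.2, hy.1.2, ← add_smul, hst,
        one_smul]
    · have : partialTranspose (s • x + t • y) =
          s • partialTranspose x + t • partialTranspose y := by
        ext p q; simp [partialTranspose]
      rw [this]
      exact (hx.2.smul hs).add (hy.2.smul ht)

lemma mem_separableStates_of_trace_eq_one {X : Matrix (a × b) (a × b) ℂ}
    (hX : X ∈ separableCone a b) (h1 : X.trace = 1) : X ∈ separableStates a b := by
  rcases eq_zero_or_smul_separable hX with rfl | ⟨t, _, σ, hσ, rfl⟩
  · simp at h1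
  · rw [Matrix.trace_smul, (separableStates_subset_pptStates hσ).1.2, Complex.real_smul,
      mul_one, Complex.ofReal_eq_one] at h1
    rwa [h1, one_smul]

end SeparableCone

/-! ### Fidelity bound for PPT states. -/

section Fidelity

/-- Evaluating the quadratic form of `M` on e_p - e_{s(p)} bounds twice each entry M p (s p) by two
diagonal entries; summing over the permutation counts every diagonal entry twice. -/
lemma re_sum_apply_le_re_trace {ι : Type*} [Fintype ι] [DecidableEq ι] {M : Matrix ι ι ℂ}
    (hM : M.PosSemidef) (s : Equiv.Perm ι) : (∑ p, M p (s p)).re ≤ M.trace.re := by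
  have h : ∀ p, 0 ≤ (M p p).re + (M (s p) (s p)).re - 2 * (M p (s p)).re := by
    intro p
    have h1 := (Complex.nonneg_iff.mp
      (hM.dotProduct_mulVec_nonneg (Pi.single p 1 - Pi.single (s p) 1))).1
    have h2 : (M (s p) p).re = (M p (s p)).re := by
      rw [← hM.isHermitian.apply (s p) p]; simp
    simp only [star_sub, Pi.star_single, star_one, Matrix.mulVec_sub, sub_dotProduct,
      dotProduct_sub, Matrix.mulVec_single_one, single_one_dotProduct, Matrix.col_apply,
      Complex.sub_re, h2] at h1
    linarith
  have h3 := Finset.sum_nonneg fun p (_ : p ∈ Finset.univ) => h p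
  rw [Finset.sum_sub_distrib, Finset.sum_add_distrib, ← Finset.mul_sum,
    Equiv.sum_comp s fun p => (M p p).re] at h3
  simp only [Matrix.trace, Matrix.diag, Complex.re_sum]
  linarith

/-- The partial transpose of Φ is the swap divided by the dimension, so the fidelity is the swap
expectation of the partial transpose of `σ`, over the dimension. That expectation is at most the
trace, which is 1. -/
lemma re_trace_maxEnt_mul_le {n : Type} [Fintype n] [DecidableEq n]
    {σ : Matrix (n × n) (n × n) ℂ} (hσ : σ ∈ pptStates n n) :
    (maxEnt n * σ).trace.re ≤ (Fintype.card n : ℝ)⁻¹ := by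
  have h := re_sum_apply_le_re_trace hσ.2 (Equiv.prodComm n n)
  have ht : (partialTranspose σ).trace = 1 := hσ.1.2
  have hs : ∑ p, partialTranspose σ p (Equiv.prodComm n n p) = ∑ i, ∑ j, σ (i, i) (j, j) := by
    rw [Fintype.sum_prod_type]; rfl
  rw [ht, hs, Complex.one_re] at h
  rw [trace_maxEnt_mul, ← Complex.ofReal_natCast, ← Complex.ofReal_inv, Complex.re_ofReal_mul]
  exact mul_le_of_le_one_right (by positivity) h

end Fidelity


/-! ### Explicit separable decomposition of isotropic states. -/

section Twirl

variable {n : Type} [Fintype n] [DecidableEq n]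

omit [Fintype n] in
-- Coefficients modulo 3 suffice to tell the multisets {i, l} and {j, k} apart. Modulo 2 they would
-- not: 2e_i = 2e_j = 0 would give spurious solutions.
lemma single_add_single_eq_iff (i j k l : n) :
    (Pi.single i 1 + Pi.single l 1 : n → ZMod 3) = Pi.single j 1 + Pi.single k 1 ↔
      (i = j ∧ l = k) ∨ (i = k ∧ l = j) := by
  constructor
  · intro h
    have hi := congrFun h i
    have hl := congrFun h l
    have hj := congrFun h j
    have hk := congrFun h k
    simp only [Pi.add_apply, Pi.single_apply] at hi hl hj hk
    by_cases h1 : i = j <;> by_cases h2 : i = k <;> by_cases h3 : l = j <;> by_cases h4 : l = k <;>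
      by_cases h5 : i = l <;> simp_all (decide := true)
  · rintro (⟨rfl, rfl⟩ | ⟨rfl, rfl⟩)
    · rfl
    · exact add_comm _ _

variable [AddCommGroup n]

/-- The vector `(i, j) ↦ χ(e_i) · conj χ(e_j) · η(j)`, a product of two vectors. -/
noncomputable def phaseVec (χ : AddChar (n → ZMod 3) ℂ) (η : AddChar n ℂ) : n × n → ℂ :=
  fun p => χ (Pi.single p.1 1) * (χ (-Pi.single p.2 1) * η p.2)

/-- The average of the projections on the vectors `phaseVec χ η` over all characters `χ`. -/
noncomputable def phaseTwirl (η : AddChar n ℂ) : Matrix (n × n) (n × n) ℂ :=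
  ((Fintype.card (n → ZMod 3) : ℝ)⁻¹) •
    ∑ χ : AddChar (n → ZMod 3) ℂ, vecMulVec (phaseVec χ η) (star (phaseVec χ η))

lemma phaseTwirl_mem_separableCone (η : AddChar n ℂ) : phaseTwirl η ∈ separableCone n n := by
  refine smul_mem_separableCone (sum_mem fun χ _ => ?_) (by positivity)
  have h := kronecker_mem_separableCone
    (Matrix.posSemidef_vecMulVec_self_star fun i : n => χ (Pi.single i 1))
    (Matrix.posSemidef_vecMulVec_self_star fun j : n => χ (-Pi.single j 1) * η j)
  convert h using 1
  ext p q
  simp only [phaseVec, vecMulVec_apply, Pi.star_apply, star_mul', Matrix.kroneckerMap_apply]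
  ring

/-- Orthogonality of characters kills every entry whose phase depends on `χ`. What survives is the
joint support of Φ and the identity, weighted by `η`. -/
lemma phaseTwirl_apply (η : AddChar n ℂ) (p q : n × n) :
    phaseTwirl η p q =
      if (p.1 = p.2 ∧ q.2 = q.1) ∨ (p.1 = q.1 ∧ q.2 = p.2) then η (p.2 - q.2) else 0 := by
  have hc : (Fintype.card (n → ZMod 3) : ℂ) ≠ 0 := by exact_mod_cast Fintype.card_ne_zero
  have h : ∀ χ : AddChar (n → ZMod 3) ℂ,
      vecMulVec (phaseVec χ η) (star (phaseVec χ η)) p q =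
        χ (Pi.single p.1 1 + Pi.single q.2 1 - (Pi.single p.2 1 + Pi.single q.1 1)) *
          η (p.2 - q.2) := by
    intro χ
    rw [vecMulVec_apply, Pi.star_apply]
    simp only [phaseVec, ← starRingEnd_apply, map_mul,
      ← AddChar.map_neg_eq_conj, neg_neg, sub_eq_add_neg, AddChar.map_add_eq_mul, neg_add]
    ring
  simp only [phaseTwirl, Matrix.smul_apply, Matrix.sum_apply, h, ← Finset.sum_mul,
    AddChar.sum_apply_eq_ite, sub_eq_zero, single_add_single_eq_iff]
  split_ifs
  · rw [Complex.real_smul, Complex.ofReal_inv, Complex.ofReal_natCast, inv_mul_cancel_left₀ hc]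
  · simp

omit [AddCommGroup n] in
lemma diagonal_mem_separableCone (f : n × n → ℝ) (hf : ∀ p, 0 ≤ f p) :
    diagonal (fun p => (f p : ℂ)) ∈ separableCone n n := by
  have h : diagonal (fun p => (f p : ℂ)) =
      ∑ p : n × n, f p • (Matrix.diagonal (Pi.single p.1 (1 : ℂ)) ⊗ₖ
        Matrix.diagonal (Pi.single p.2 (1 : ℂ))) := by
    ext p q
    simp only [diagonal_kronecker_diagonal, Matrix.sum_apply, Matrix.smul_apply, diagonal_apply]
    split_ifs with hpq
    · rw [Finset.sum_eq_single p]
      · simp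
      · intro r _ hr
        have : ¬ (p.1 = r.1 ∧ p.2 = r.2) := fun h => hr (Prod.ext h.1 h.2).symm
        rw [not_and_or] at this
        rcases this with h | h <;> simp [Pi.single_apply, h]
      · simp
    · simp
  rw [h]
  refine sum_mem fun p _ => smul_mem_separableCone (kronecker_mem_separableCone ?_ ?_) (hf p) <;>
  · refine Matrix.PosSemidef.diagonal fun i => ?_
    rw [Pi.single_apply]; split_ifs <;> simp

/-- The supports of the identity and of Φ overlap at the diagonal positions (i, i). The twirl counts
the overlap once instead of twice, and the diagonal matrix supplies the missing unit. -/
lemma one_add_card_smul_maxEnt_mem_separableCone :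
    1 + (Fintype.card n : ℝ) • maxEnt n ∈ separableCone n n := by
  have hD : (Fintype.card n : ℂ) ≠ 0 := by exact_mod_cast Fintype.card_ne_zero
  have h : 1 + (Fintype.card n : ℝ) • maxEnt n = phaseTwirl 0 +
      diagonal (fun p : n × n => ((if p.1 = p.2 then 1 else 0 : ℝ) : ℂ)) := by
    ext ⟨i, j⟩ ⟨k, l⟩
    simp only [Matrix.add_apply, Matrix.smul_apply, maxEnt_apply, phaseTwirl_apply,
      Matrix.one_apply, diagonal_apply, Complex.real_smul, AddChar.zero_apply, Prod.mk.injEq,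
      Complex.ofReal_zero, Complex.ofReal_one, apply_ite Complex.ofReal,
      Complex.ofReal_natCast, mul_ite, mul_inv_cancel₀ hD, mul_zero]
    split_ifs <;> grind
  rw [h]
  refine add_mem (phaseTwirl_mem_separableCone 0) (diagonal_mem_separableCone _ fun p => ?_)
  split_ifs <;> simp

/-- Summing over nontrivial `η` turns the weight η(j - l) into D·[j = l] - 1, hence -1 on the
off-diagonal entries of Φ and D - 1 on the diagonal. Diagonal positions with i ≠ j need D, so one
unit is added there. -/
lemma card_sub_card_smul_maxEnt_mem_separableCone :
    (Fintype.card n : ℝ) • (1 - maxEnt n) ∈ separableCone n n := by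
  have hD : (Fintype.card n : ℂ) ≠ 0 := by exact_mod_cast Fintype.card_ne_zero
  have hs : ∀ a : n, ∑ η ∈ Finset.univ.erase (0 : AddChar n ℂ), η a =
      (if a = 0 then (Fintype.card n : ℂ) else 0) - 1 := by
    intro a
    rw [Finset.sum_erase_eq_sub (Finset.mem_univ _), AddChar.sum_apply_eq_ite,
      AddChar.zero_apply]
  have h : (Fintype.card n : ℝ) • (1 - maxEnt n) =
      (∑ η ∈ Finset.univ.erase (0 : AddChar n ℂ), phaseTwirl η) +
      diagonal (fun p : n × n => ((if p.1 = p.2 then 0 else 1 : ℝ) : ℂ)) := by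
    ext ⟨i, j⟩ ⟨k, l⟩
    simp only [Matrix.add_apply, Matrix.sub_apply, Matrix.smul_apply, maxEnt_apply,
      phaseTwirl_apply, Matrix.sum_apply, Finset.sum_ite_irrel, hs, Finset.sum_const_zero,
      Matrix.one_apply, diagonal_apply, Complex.real_smul, Prod.mk.injEq,
      Complex.ofReal_zero, Complex.ofReal_one, apply_ite Complex.ofReal,
      Complex.ofReal_natCast, mul_sub, mul_ite, mul_inv_cancel₀ hD, mul_zero, mul_one,
      sub_eq_zero]
    split_ifs <;> grind
  rw [h]
  refine add_mem (sum_mem fun η _ => phaseTwirl_mem_separableCone η)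
    (diagonal_mem_separableCone _ fun p => ?_)
  split_ifs <;> simp

/-- Isotropic states with `α ≥ 1 - 1/D` are separable. -/
lemma isotropic_mem_separableStates [Nontrivial n] {α : ℝ}
    (h0 : 1 - (Fintype.card n : ℝ)⁻¹ ≤ α) (h1 : α ≤ 1) :
    isotropic n α ∈ separableStates n n := by
  have hD : (1 : ℝ) < Fintype.card n := by exact_mod_cast Fintype.one_lt_card
  have hD2 := card_sq_sub_one_pos (n := n)
  have hinv : (Fintype.card n : ℝ)⁻¹ ≤ 1 := inv_le_one_of_one_le₀ hD.le
  refine mem_separableStates_of_trace_eq_one ?_ (isotropic_isState (by linarith) h1).2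
  set D : ℝ := (Fintype.card n : ℝ) with hDdef
  -- The second generator vanishes on Φ, so the eigenvalue 1 - α there fixes the first weight. The
  -- second weight then matches the eigenvalue α/(D² - 1) on the complement; it is nonnegative
  -- exactly when α ≥ 1 - 1/D.
  have hu : 0 ≤ (1 - α) / (1 + D) := div_nonneg (by linarith) (by linarith)
  have hw : 0 ≤ (α * D - (D - 1)) / (D ^ 2 * (D ^ 2 - 1)) := by
    refine div_nonneg ?_ (by positivity)
    have := mul_le_mul_of_nonneg_right h0 (by linarith : 0 ≤ D)
    rw [sub_mul, inv_mul_cancel₀ (by linarith)] at this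
    linarith
  have h := add_mem (smul_mem_separableCone (one_add_card_smul_maxEnt_mem_separableCone (n := n)) hu)
    (smul_mem_separableCone (smul_mem_separableCone
      (card_sub_card_smul_maxEnt_mem_separableCone (n := n)) (by linarith : 0 ≤ D)) hw)
  convert h using 1
  rw [isotropic, ← hDdef]
  have hne : D ^ 2 - 1 ≠ 0 := hD2.ne'
  have hne' : 1 + D ≠ 0 := by linarith
  have hne2 : D ≠ 0 := by linarith
  match_scalars <;> field_simp <;> ring

end Twirl


/-! ### Channels with product Kraus operators, and LOCC among them. -/

section Kronecker

variable {ι l m n p : Type*} [Fintype ι]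

lemma sum_kronecker (f : ι → Matrix l m ℂ) (B : Matrix n p ℂ) :
    (∑ i, f i) ⊗ₖ B = ∑ i, f i ⊗ₖ B := by
  ext x y
  simp [Matrix.sum_apply, Finset.sum_mul]

lemma kronecker_sum (A : Matrix l m ℂ) (f : ι → Matrix n p ℂ) :
    A ⊗ₖ (∑ i, f i) = ∑ i, A ⊗ₖ f i := by
  ext x y
  simp [Matrix.sum_apply, Finset.mul_sum]

end Kronecker

section Channels

lemma sandwich_apply {n m : Type*} [Fintype n] (K : Matrix m n ℂ) (X : Matrix n n ℂ) :
    sandwich K X = K * X * Kᴴ := rfl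

lemma sandwich_comp_sandwich {n m l : Type*} [Fintype n] [Fintype m] (K : Matrix m n ℂ)
    (M : Matrix l m ℂ) : sandwich M ∘ₗ sandwich K = sandwich (M * K) := by
  ext1 X
  simp [sandwich_apply, Matrix.mul_assoc]

lemma sandwich_one {n : Type*} [Fintype n] [DecidableEq n] :
    sandwich (1 : Matrix n n ℂ) = LinearMap.id := by
  ext1 X
  simp [sandwich_apply]

lemma trace_sandwich {n m : Type*} [Fintype n] [Fintype m] (K : Matrix m n ℂ)
    (X : Matrix n n ℂ) : (sandwich K X).trace = (Kᴴ * K * X).trace := by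
  rw [sandwich_apply, Matrix.trace_mul_comm, Matrix.mul_assoc]

lemma IsChannel.posSemidef {n m : Type*} [Fintype n] [Fintype m]
    {Λ : SuperOp n m} (h : IsChannel Λ) {X : Matrix n n ℂ} (hX : X.PosSemidef) :
    (Λ X).PosSemidef :=
  (h.1 1 (X.submatrix Prod.snd Prod.snd) (hX.submatrix _)).submatrix fun i => (0, i)

lemma IsChannel.isState {n m : Type*} [Fintype n] [Fintype m]
    {Λ : SuperOp n m} (h : IsChannel Λ) {X : Matrix n n ℂ} (hX : IsState X) : IsState (Λ X) :=
  ⟨h.posSemidef hX.1, (h.2 X).trans hX.2⟩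

lemma amplify_sandwich {n m : Type*} [Fintype n] [Fintype m] (d : ℕ)
    (K : Matrix m n ℂ) (X : Matrix (Fin d × n) (Fin d × n) ℂ) :
    amplify d (sandwich K) X =
      ((1 : Matrix (Fin d) (Fin d) ℂ) ⊗ₖ K) * X * ((1 : Matrix (Fin d) (Fin d) ℂ) ⊗ₖ K)ᴴ := by
  ext p q
  simp [amplify, sandwich_apply, Matrix.mul_apply, Matrix.kroneckerMap_apply, Matrix.one_apply,
    Fintype.sum_prod_type, ite_mul, Finset.sum_ite_irrel, apply_ite (starRingEnd ℂ)]

variable {a b c d : Type} [Fintype a] [DecidableEq a] [Fintype b] [DecidableEq b]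
  [Fintype c] [DecidableEq c] [Fintype d] [DecidableEq d]

/-- Completely positive maps with Kraus operators of product form. -/
def productKraus (a b c d : Type) [Fintype a] [Fintype b] :
    AddSubmonoid (SuperOp (a × b) (c × d)) :=
  AddSubmonoid.closure {Λ | ∃ (A : Matrix c a ℂ) (B : Matrix d b ℂ), Λ = sandwich (A ⊗ₖ B)}

omit [DecidableEq a] [DecidableEq b] [Fintype c] [DecidableEq c] [Fintype d] [DecidableEq d] in
lemma sandwich_mem_productKraus (A : Matrix c a ℂ) (B : Matrix d b ℂ) :
    sandwich (A ⊗ₖ B) ∈ productKraus a b c d :=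
  AddSubmonoid.subset_closure ⟨A, B, rfl⟩

omit [DecidableEq a] [DecidableEq b] [DecidableEq c] [DecidableEq d] in
lemma isSeparableOperation_of_mem_productKraus {Λ : SuperOp (a × b) (c × d)}
    (h : Λ ∈ productKraus a b c d) (ht : ∀ X, (Λ X).trace = X.trace) :
    IsSeparableOperation Λ := by
  refine ⟨⟨fun e X hX => ?_, ht⟩, ?_⟩
  · clear ht
    induction h using AddSubmonoid.closure_induction with
    | mem Λ hΛ =>
      obtain ⟨A, B, rfl⟩ := hΛ
      rw [amplify_sandwich]
      exact hX.mul_mul_conjTranspose_same _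
    | zero => exact Matrix.PosSemidef.zero
    | add Λ Λ' _ _ h h' => exact h.add h'
  · clear ht
    induction h using AddSubmonoid.closure_induction with
    | mem Λ hΛ =>
      obtain ⟨A, B, rfl⟩ := hΛ
      exact ⟨1, fun _ => A, fun _ => B, by simp⟩
    | zero => exact ⟨0, Fin.elim0, Fin.elim0, by simp⟩
    | add Λ Λ' _ _ h h' =>
      obtain ⟨r, A, B, rfl⟩ := h
      obtain ⟨s, A', B', rfl⟩ := h'
      exact ⟨r + s, Fin.append A A', Fin.append B B', by simp [Fin.sum_univ_add]⟩

/-- Separable operations preserve separability. -/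
lemma IsSeparableOperation.isSeparabilityPreserving {Λ : SuperOp (a × b) (c × d)}
    (h : IsSeparableOperation Λ) : IsSeparabilityPreserving Λ := by
  refine ⟨h.1, fun σ hσ => ?_⟩
  refine mem_separableStates_of_trace_eq_one ?_
    ((h.1.2 σ).trans (separableStates_subset_pptStates hσ).1.2)
  obtain ⟨-, r, A, B, rfl⟩ := h
  rw [LinearMap.sum_apply]
  exact sum_mem fun i _ =>
    sandwich_mem_separableCone (separableStates_subset_separableCone hσ) _ _

omit [DecidableEq a] [DecidableEq b] [DecidableEq c] [Fintype c] [DecidableEq d] [Fintype d] in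
lemma comp_sandwich_mem_productKraus {a' b' : Type} [Fintype a'] [Fintype b']
    {Λ : SuperOp (a' × b') (c × d)} (h : Λ ∈ productKraus a' b' c d)
    (K : Matrix a' a ℂ) (M : Matrix b' b ℂ) :
    Λ ∘ₗ sandwich (K ⊗ₖ M) ∈ productKraus a b c d := by
  induction h using AddSubmonoid.closure_induction with
  | mem Λ hΛ =>
    obtain ⟨A, B, rfl⟩ := hΛ
    rw [sandwich_comp_sandwich, ← Matrix.mul_kronecker_mul]
    exact sandwich_mem_productKraus _ _
  | zero => rw [LinearMap.zero_comp]; exact zero_mem _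
  | add Λ Λ' _ _ h h' => rw [LinearMap.add_comp]; exact add_mem h h'

/-- LOCC channels are separable operations. -/
lemma IsLOCC.isSeparableOperation {Λ : SuperOp (a × b) (c × d)} (h : IsLOCC Λ) :
    IsSeparableOperation Λ := by
  -- Single branches of a protocol need not preserve the trace, so the induction carries the product
  -- Kraus form and the trace condition separately.
  suffices h : Λ ∈ productKraus a b c d ∧ ∀ X, (Λ X).trace = X.trace from
    isSeparableOperation_of_mem_productKraus h.1 h.2
  induction h with
  | done =>
    refine ⟨?_, fun X => rfl⟩
    rw [← sandwich_one, ← Matrix.one_kronecker_one]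
    exact sandwich_mem_productKraus _ _
  | alice r a' K hK Λ hΛ ih =>
    refine ⟨sum_mem fun i _ => comp_sandwich_mem_productKraus (ih i).1 _ _, fun X => ?_⟩
    simp only [LinearMap.sum_apply, LinearMap.comp_apply, Matrix.trace_sum, (ih _).2,
      trace_sandwich, Matrix.conjTranspose_kronecker, ← Matrix.mul_kronecker_mul,
      Matrix.conjTranspose_one, Matrix.one_mul]
    rw [← Matrix.trace_sum, ← Finset.sum_mul, ← sum_kronecker, hK, Matrix.one_kronecker_one,
      Matrix.one_mul]
  | bob r b' K hK Λ hΛ ih =>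
    refine ⟨sum_mem fun i _ => comp_sandwich_mem_productKraus (ih i).1 _ _, fun X => ?_⟩
    simp only [LinearMap.sum_apply, LinearMap.comp_apply, Matrix.trace_sum, (ih _).2,
      trace_sandwich, Matrix.conjTranspose_kronecker, ← Matrix.mul_kronecker_mul,
      Matrix.conjTranspose_one, Matrix.one_mul]
    rw [← Matrix.trace_sum, ← Finset.sum_mul, ← kronecker_sum, hK, Matrix.one_kronecker_one,
      Matrix.one_mul]

end Channels

/-! ### LOCC preparation of separable states. -/

section LOCCProtocols

variable {a b c d : Type} [Fintype a] [DecidableEq a] [Fintype b] [DecidableEq b]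
  [Fintype c] [DecidableEq c] [Fintype d] [DecidableEq d]

lemma IsLOCC.alice_fintype {ι a' : Type} [Fintype ι] [Fintype a'] [DecidableEq a']
    (K : ι → Matrix a' a ℂ) (hK : ∑ i, (K i)ᴴ * K i = 1)
    (Λ : ι → SuperOp (a' × b) (c × d)) (hΛ : ∀ i, IsLOCC (Λ i)) :
    IsLOCC (∑ i, Λ i ∘ₗ sandwich (K i ⊗ₖ (1 : Matrix b b ℂ))) := by
  let e := (Fintype.equivFin ι).symm
  rw [← Equiv.sum_comp e] at hK ⊢
  exact IsLOCC.alice _ (fun _ => a') (fun i => K (e i)) hK (fun i => Λ (e i)) fun i => hΛ _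

lemma IsLOCC.bob_fintype {ι b' : Type} [Fintype ι] [Fintype b'] [DecidableEq b']
    (K : ι → Matrix b' b ℂ) (hK : ∑ i, (K i)ᴴ * K i = 1)
    (Λ : ι → SuperOp (a × b') (c × d)) (hΛ : ∀ i, IsLOCC (Λ i)) :
    IsLOCC (∑ i, Λ i ∘ₗ sandwich ((1 : Matrix a a ℂ) ⊗ₖ K i)) := by
  let e := (Fintype.equivFin ι).symm
  rw [← Equiv.sum_comp e] at hK ⊢
  exact IsLOCC.bob _ (fun _ => b') (fun i => K (e i)) hK (fun i => Λ (e i)) fun i => hΛ _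

/-- The map `X ↦ tr(X) σ`. -/
noncomputable def preparation {n m : Type*} [Fintype n] (σ : Matrix m m ℂ) : SuperOp n m :=
  (Matrix.traceLinearMap n ℂ ℂ).smulRight σ

lemma preparation_apply {n m : Type*} [Fintype n] (σ : Matrix m m ℂ) (X : Matrix n n ℂ) :
    preparation σ X = X.trace • σ := rfl

/-- The Kraus operators S|i⟩⟨j| measure the input in the basis, forget the outcome `j`, and emit
S|i⟩; summing over `i` yields S S†. -/
lemma sum_sandwich_single {n m : Type*} [Fintype n] [DecidableEq n] [Fintype m] [DecidableEq m]
    (S : Matrix m m ℂ) :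
    ∑ p : m × n, sandwich (S * Matrix.single p.1 p.2 (1 : ℂ)) = preparation (S * Sᴴ) := by
  ext1 X
  simp only [LinearMap.sum_apply, sandwich_apply, preparation_apply, Matrix.conjTranspose_mul,
    Matrix.conjTranspose_single, star_one]
  have h : ∀ p : m × n, S * Matrix.single p.1 p.2 (1 : ℂ) * X * (Matrix.single p.2 p.1 (1 : ℂ) * Sᴴ) =
      S * (X p.2 p.2 • Matrix.single p.1 p.1 (1 : ℂ)) * Sᴴ := by
    intro p
    have : Matrix.single p.1 p.2 (1 : ℂ) * X * Matrix.single p.2 p.1 (1 : ℂ) =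
        X p.2 p.2 • Matrix.single p.1 p.1 (1 : ℂ) := by
      rw [Matrix.single_mul_mul_single]; simp
    rw [← this]; simp only [Matrix.mul_assoc]
  simp only [h, Fintype.sum_prod_type, ← Finset.sum_mul, ← Finset.mul_sum, ← Finset.sum_smul]
  have h1 : ∑ x : m, Matrix.single x x (1 : ℂ) = 1 := by
    ext i j
    simp [Matrix.sum_apply, Matrix.single_apply, Matrix.one_apply, ite_and]
  rw [← Finset.smul_sum, h1]
  simp [Matrix.trace]

lemma sum_conjTranspose_mul_single {n m : Type*} [Fintype n] [DecidableEq n] [Fintype m]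
    [DecidableEq m] {S : Matrix m m ℂ} (hS : (S * Sᴴ).trace = 1) :
    ∑ p : m × n, (S * Matrix.single p.1 p.2 (1 : ℂ))ᴴ * (S * Matrix.single p.1 p.2 (1 : ℂ)) = 1 := by
  have h : ∀ p : m × n, (S * Matrix.single p.1 p.2 (1 : ℂ))ᴴ * (S * Matrix.single p.1 p.2 (1 : ℂ)) =
      (Sᴴ * S) p.1 p.1 • Matrix.single p.2 p.2 (1 : ℂ) := by
    intro p
    have : Matrix.single p.2 p.1 (1 : ℂ) * (Sᴴ * S) * Matrix.single p.1 p.2 (1 : ℂ) =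
        (Sᴴ * S) p.1 p.1 • Matrix.single p.2 p.2 (1 : ℂ) := by
      rw [Matrix.single_mul_mul_single]; simp
    rw [← this]
    simp [Matrix.mul_assoc]
  have h1 : ∑ x : n, Matrix.single x x (1 : ℂ) = 1 := by
    ext i j
    simp [Matrix.sum_apply, Matrix.single_apply, Matrix.one_apply, ite_and]
  simp only [h, Fintype.sum_prod_type, ← Finset.smul_sum, h1, ← Finset.sum_smul]
  rw [Matrix.trace_mul_comm] at hS
  exact (congrArg (· • (1 : Matrix n n ℂ)) hS).trans (one_smul _ _)

/-- The preparation of a separable state is an LOCC channel. -/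
lemma isLOCC_preparation {σ : Matrix (c × d) (c × d) ℂ} (hσ : σ ∈ separableStates c d) :
    IsLOCC (preparation σ : SuperOp (a × b) (c × d)) := by
  suffices h : separableStates c d ⊆
      {σ | IsLOCC (preparation σ : SuperOp (a × b) (c × d))} from h hσ
  refine convexHull_min ?_ ?_
  · rintro _ ⟨σ, τ, hσ, hτ, rfl⟩
    -- With σ = S S† and τ = T T†, each party replaces its own system in turn. The composed Kraus
    -- operators are those of S ⊗ T, up to reordering the index set.
    obtain ⟨S, hS⟩ := CStarAlgebra.nonneg_iff_eq_mul_star_self.mp hσ.1.nonneg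
    obtain ⟨T, hT⟩ := CStarAlgebra.nonneg_iff_eq_mul_star_self.mp hτ.1.nonneg
    rw [star_eq_conjTranspose] at hS hT
    have hsum : ∀ (f : d × b → SuperOp (c × b) (c × d)) (g : SuperOp (a × b) (c × b)),
        (∑ p, f p) ∘ₗ g = ∑ p, f p ∘ₗ g := fun f g => by
      ext1 X; simp only [LinearMap.comp_apply, LinearMap.sum_apply]
    have h := IsLOCC.alice_fintype (b := b) (fun p : c × a => S * Matrix.single p.1 p.2 (1 : ℂ))
      (sum_conjTranspose_mul_single (hS ▸ hσ.2)) _ fun _ =>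
        IsLOCC.bob_fintype (a := c) (fun p : d × b => T * Matrix.single p.1 p.2 (1 : ℂ))
          (sum_conjTranspose_mul_single (hT ▸ hτ.2)) _ fun _ => IsLOCC.done
    rw [Set.mem_ofPred_eq]
    convert h using 1
    rw [hS, hT, Matrix.mul_kronecker_mul, ← Matrix.conjTranspose_kronecker, ← sum_sandwich_single]
    simp only [LinearMap.id_comp, hsum, sandwich_comp_sandwich,
      ← Matrix.mul_kronecker_mul, Matrix.one_mul, Matrix.mul_one]
    rw [← Finset.sum_product', Finset.univ_product_univ]
    refine (Equiv.sum_comp (Equiv.prodProdProdComm c a d b) _).symm.trans ?_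
    refine Finset.sum_congr rfl fun x _ => ?_
    simp [Matrix.mul_kronecker_mul, Matrix.single_kronecker_single]
  · intro x hx y hy s t hs ht hst
    -- A convex combination is a coin tossed by the first party: the Kraus operators √s · 1 and √t ·
    -- 1 leave the state unchanged and announce which preparation follows.
    have h := IsLOCC.alice_fintype (a := a) (b := b)
      (fun i : Bool => ((√(if i then s else t) : ℝ) : ℂ) • (1 : Matrix a a ℂ)) (by
        simp [smul_smul, Real.mul_self_sqrt, hs, ht, ← add_smul, hst])
      (fun i => preparation (if i then x else y)) (by rintro (_ | _) <;> assumption)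
    rw [Set.mem_ofPred_eq]
    convert h using 1
    ext1 X
    simp [preparation_apply, sandwich_apply, smul_smul, Real.mul_self_sqrt, hs, ht, smul_comm X.trace, Matrix.smul_kronecker]

end LOCCProtocols


/-! ### The optimal LOCC protocol from k to m qubit pairs. -/

section Collapse

variable {c s n : Type} [Fintype c] [DecidableEq c] [Fintype s] [DecidableEq s]
  [Fintype n] [DecidableEq n] (e : c × s ≃ n)

/-- The operator `1 ⊗ ⟨t|` on a system identified with `c × s`. -/
def projectOut (t : s) : Matrix c n ℂ := Matrix.of fun x y => if e (x, t) = y then 1 else 0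

omit [Fintype n] in
lemma sum_projectOut : ∑ t, (projectOut e t)ᴴ * projectOut e t = 1 := by
  ext i j
  obtain ⟨⟨x, t⟩, rfl⟩ := e.surjective i
  obtain ⟨⟨y, u⟩, rfl⟩ := e.surjective j
  simp only [Matrix.sum_apply, Matrix.mul_apply, conjTranspose_apply, projectOut, Matrix.of_apply,
    EmbeddingLike.apply_eq_iff_eq, Prod.mk.injEq, Matrix.one_apply]
  rw [Finset.sum_comm]
  simp [ite_and, apply_ite (starRingEnd ℂ), eq_comm (a := x), eq_comm (a := t)]

omit [Fintype c] [DecidableEq c] [Fintype s] [DecidableEq s] in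
lemma sandwich_projectOut (t u : s) (X : Matrix (n × n) (n × n) ℂ) :
    sandwich (projectOut e t ⊗ₖ projectOut e u) X =
      X.submatrix (fun p => (e (p.1, t), e (p.2, u))) (fun p => (e (p.1, t), e (p.2, u))) := by
  ext p q
  simp [sandwich_apply, Matrix.mul_apply, Matrix.kroneckerMap_apply, projectOut,
    Fintype.sum_prod_type, apply_ite (starRingEnd ℂ)]

/-- Both parties measure the subsystem `s`. If the outcomes agree, they keep the subsystem `c`,
otherwise they prepare the state `σ`. -/
noncomputable def collapse (σ : Matrix (c × c) (c × c) ℂ) : SuperOp (n × n) (c × c) :=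
  ∑ t, (∑ u, (if t = u then LinearMap.id else preparation σ) ∘ₗ
    sandwich ((1 : Matrix c c ℂ) ⊗ₖ projectOut e u)) ∘ₗ
      sandwich (projectOut e t ⊗ₖ (1 : Matrix n n ℂ))

lemma isLOCC_collapse {σ : Matrix (c × c) (c × c) ℂ} (hσ : σ ∈ separableStates c c) :
    IsLOCC (collapse e σ) := by
  refine IsLOCC.alice_fintype _ (sum_projectOut e) _ fun t =>
    IsLOCC.bob_fintype _ (sum_projectOut e) _ fun u => ?_
  split_ifs
  · exact IsLOCC.done
  · exact isLOCC_preparation hσ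

lemma collapse_apply (σ : Matrix (c × c) (c × c) ℂ) (X : Matrix (n × n) (n × n) ℂ) :
    collapse e σ X = ∑ t, ∑ u, (if t = u then LinearMap.id else preparation σ)
      (sandwich (projectOut e t ⊗ₖ projectOut e u) X) := by
  simp only [collapse, LinearMap.sum_apply, LinearMap.comp_apply]
  refine Finset.sum_congr rfl fun t _ => Finset.sum_congr rfl fun u _ => ?_
  rw [← LinearMap.comp_apply (sandwich _) (sandwich _), sandwich_comp_sandwich,
    ← Matrix.mul_kronecker_mul, Matrix.one_mul, Matrix.mul_one]

/-- Φ factorises over the two subsystems and its measured factor always gives equal outcomes, so the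
fallback state `σ` never appears. -/
lemma collapse_maxEnt [Nonempty s] (σ : Matrix (c × c) (c × c) ℂ) :
    collapse e σ (maxEnt n) = maxEnt c := by
  have hs : (Fintype.card s : ℂ) ≠ 0 := by exact_mod_cast Fintype.card_ne_zero
  have hcard : Fintype.card n = Fintype.card c * Fintype.card s := by
    rw [← Fintype.card_prod, Fintype.card_congr e]
  have h : ∀ t u, (if t = u then LinearMap.id else preparation σ)
      (sandwich (projectOut e t ⊗ₖ projectOut e u) (maxEnt n)) =
        if t = u then (Fintype.card s : ℂ)⁻¹ • maxEnt c else 0 := by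
    intro t u
    rw [sandwich_projectOut]
    split_ifs with htu
    · subst htu
      ext p q
      simp only [LinearMap.id_apply, submatrix_apply, maxEnt_apply, Matrix.smul_apply,
        EmbeddingLike.apply_eq_iff_eq, Prod.mk.injEq, and_true, hcard, Nat.cast_mul, mul_inv,
        smul_eq_mul, mul_ite, mul_zero, mul_comm]
    · simp [preparation_apply, Matrix.trace, maxEnt_apply, htu]
  rw [collapse_apply]
  simp only [h, Finset.sum_ite_eq, Finset.mem_univ, if_true, Finset.sum_const, Finset.card_univ]
  rw [← Nat.cast_smul_eq_nsmul ℂ, smul_smul, mul_inv_cancel₀ hs, one_smul]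

/-- Every pair of outcomes leaves the identity on `c × c`, of trace |c|². The |s| agreeing pairs
keep it, and the |s|(|s| - 1) others replace it by a multiple of `σ`. -/
lemma collapse_one (σ : Matrix (c × c) (c × c) ℂ) :
    collapse e σ 1 = (Fintype.card s : ℝ) • (1 : Matrix (c × c) (c × c) ℂ) +
      ((Fintype.card s : ℝ) * (Fintype.card s - 1) * (Fintype.card c : ℝ) ^ 2) • σ := by
  have h : ∀ t u, (if t = u then LinearMap.id else preparation σ)
      (sandwich (projectOut e t ⊗ₖ projectOut e u) 1) =
        ((Fintype.card c : ℝ) ^ 2) • σ +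
          if t = u then (1 : Matrix (c × c) (c × c) ℂ) - ((Fintype.card c : ℝ) ^ 2) • σ else 0 := by
    intro t u
    have h1 : sandwich (projectOut e t ⊗ₖ projectOut e u) (1 : Matrix (n × n) (n × n) ℂ) = 1 := by
      rw [sandwich_projectOut]
      exact Matrix.submatrix_one _ fun p q hpq => by simpa [Prod.ext_iff] using hpq
    rw [h1]
    split_ifs with htu
    · simp
    · rw [preparation_apply, Matrix.trace_one, Fintype.card_prod, add_zero, ← Complex.coe_smul]
      push_cast
      rw [sq]
  rw [collapse_apply]
  simp only [h, Finset.sum_add_distrib, Finset.sum_ite_eq, Finset.mem_univ, if_true,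
    Finset.sum_const, Finset.card_univ, ← Nat.cast_smul_eq_nsmul ℝ]
  module

lemma collapse_isotropic [Nontrivial c] [Nonempty s] (α : ℝ) :
    collapse e (isotropic c (1 - (Fintype.card c : ℝ)⁻¹)) (isotropic n α) =
      isotropic c (α * (((Fintype.card n : ℝ) - Fintype.card s) / (Fintype.card n - 1))) := by
  have hcard : (Fintype.card n : ℝ) = Fintype.card c * Fintype.card s := by
    rw [← Nat.cast_mul, ← Fintype.card_prod, Fintype.card_congr e]
  have hc : (1 : ℝ) < Fintype.card c := by exact_mod_cast Fintype.one_lt_card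
  have hs : (1 : ℝ) ≤ Fintype.card s := by exact_mod_cast Fintype.card_pos
  have hn : (1 : ℝ) < Fintype.card c * Fintype.card s := by nlinarith
  rw [isotropic.eq_1 n]
  simp only [← Complex.coe_smul, map_add, map_sub, map_smul, collapse_maxEnt, collapse_one]
  simp only [Complex.coe_smul, isotropic, hcard]
  generalize (Fintype.card c : ℝ) = d at *
  generalize (Fintype.card s : ℝ) = K at *
  have h1 : d ^ 2 - 1 ≠ 0 := by nlinarith
  have h2 : d ^ 2 * K ^ 2 - 1 ≠ 0 := by nlinarith
  have h3 : d * K - 1 ≠ 0 := by linarith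
  have h4 : d ≠ 0 := by linarith
  match_scalars <;> field_simp <;> ring

end Collapse

/-! ### From optimal fidelity to overhead. -/

section Overhead

lemma one_sub_le_mul_of_feasible {N c : Type} [Fintype N] [DecidableEq N] [Fintype c]
    [DecidableEq c] [Nonempty c] {Λp Λm : SuperOp N (c × c)} (hp : IsChannel Λp)
    (hm : IsChannel Λm) {ρ : Matrix N N ℂ} (hρ : IsState ρ) {lp lm ε F : ℝ} (hlp : 0 ≤ lp)
    (hlm : 0 ≤ lm) (hl : lp - lm = 1)
    (hε : 1 / 2 * traceNorm (maxEnt c - (lp • Λp ρ - lm • Λm ρ)) ≤ ε)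
    (hF : (maxEnt c * Λp ρ).trace.re ≤ F) : 1 - ε ≤ lp * F := by
  have sp := hp.isState hρ
  have sm := hm.isState hρ
  have hlc : (lp : ℂ) - lm = 1 := by exact_mod_cast hl
  have h := re_trace_mul_le_traceNorm (X := maxEnt c - (lp • Λp ρ - lm • Λm ρ))
    maxEnt_posSemidef one_sub_maxEnt_posSemidef
    (maxEnt_isHermitian.sub ((sp.1.smul hlp).isHermitian.sub (sm.1.smul hlm).isHermitian))
    (by simp [Matrix.trace_sub, Matrix.trace_smul, sp.2, sm.2, trace_maxEnt, hlc])
  have hm0 := re_trace_mul_nonneg (maxEnt_posSemidef (n := c)) sm.1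
  simp only [Matrix.mul_sub, Matrix.mul_smul, maxEnt_mul_self, Matrix.trace_sub,
    Matrix.trace_smul, trace_maxEnt, Complex.sub_re, Complex.one_re, Complex.real_smul,
    Complex.re_ofReal_mul] at h hε
  have h1 := mul_nonneg hlm hm0
  have h2 := mul_le_mul_of_nonneg_left hF hlp
  linarith

instance {m : ℕ} [NeZero m] : Nontrivial (Qubits m) :=
  Pi.nontrivial

/-- The overhead is determined by the optimal fidelity `F` if it is attained with an isotropic
output and a free operation can prepare the isotropic state orthogonal to the target. -/
lemma overhead_eq_of_fidelity {N : Type} [Fintype N] [DecidableEq N] {m : ℕ} [NeZero m]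
    {O : Set (SuperOp N (Qubits m × Qubits m))} {ε F : ℝ} (hε₀ : 0 ≤ ε)
    {ρ : Matrix N N ℂ} (hρ : IsState ρ) (hF₀ : 0 < F) (hF₁ : F ≤ 1)
    (hO : ∀ Λ ∈ O, IsChannel Λ ∧ (maxEnt (Qubits m) * Λ ρ).trace.re ≤ F)
    (hp : ∃ Λ ∈ O, Λ ρ = isotropic (Qubits m) (1 - F))
    (hm : ∃ Λ ∈ O, Λ ρ = isotropic (Qubits m) 1) :
    overhead O ε ρ = ((max (2 * (1 - ε) / F - 1) 1 : ℝ) : EReal) := by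
  rw [overhead, bellPow_eq_maxEnt]
  apply le_antisymm
  · obtain ⟨Λp, hΛp, ep⟩ := hp
    obtain ⟨Λm, hΛm, em⟩ := hm
    set l := max ((1 - ε) / F) 1 with hl
    have hlF : l * F = max (1 - ε) F := by
      rw [hl, max_mul_of_nonneg _ _ hF₀.le, div_mul_cancel₀ _ hF₀.ne', one_mul]
    have hl1 : 1 ≤ l := le_max_right _ _
    refine sInf_le ⟨l, l - 1, Λp, Λm, by linarith, by linarith, by ring, hΛp, hΛm, ?_, ?_⟩
    · have : l • Λp ρ - (l - 1) • Λm ρ = isotropic (Qubits m) (1 - l * F) := by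
        rw [ep, em]
        simp only [isotropic]
        match_scalars <;> ring
      rw [this, traceNorm_maxEnt_sub_isotropic, hlF, abs_of_nonneg]
      · linarith [le_max_left (1 - ε) F]
      · linarith [max_le (by linarith : 1 - ε ≤ 1) hF₁]
    · congr 1
      rw [hl, show ∀ x : ℝ, x + (x - 1) = 2 * x - 1 by intro x; ring,
        mul_max_of_nonneg _ _ zero_le_two, ← max_sub_sub_right, mul_div_assoc]
      norm_num
  · refine le_sInf ?_
    rintro _ ⟨lp, lm, Λp, Λm, hlp, hlm, hl, hΛp, hΛm, hf, rfl⟩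
    have h := one_sub_le_mul_of_feasible (hO _ hΛp).1 (hO _ hΛm).1 hρ hlp hlm hl hf (hO _ hΛp).2
    rw [EReal.coe_le_coe_iff]
    refine max_le ?_ (by linarith)
    have : (1 - ε) / F ≤ lp := by rwa [div_le_iff₀ hF₀]
    rw [mul_div_assoc]
    linarith

lemma fidelity_le_of_separable {a b c : Type} [Fintype a] [DecidableEq a] [Fintype b]
    [DecidableEq b] [Fintype c] [DecidableEq c] {Λ : SuperOp (a × b) (c × c)}
    (hΛ : IsSeparabilityPreserving Λ ∨ IsPPTPreserving Λ) {σ : Matrix (a × b) (a × b) ℂ}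
    (hσ : σ ∈ separableStates a b) :
    (maxEnt c * Λ σ).trace.re ≤ (Fintype.card c : ℝ)⁻¹ :=
  re_trace_maxEnt_mul_le <| hΛ.elim
    (fun h => separableStates_subset_pptStates (h.2 σ hσ))
    (fun h => h.2 σ (separableStates_subset_pptStates hσ))

lemma fidelity_isotropic_le {n c : Type} [Fintype n] [DecidableEq n] [AddCommGroup n]
    [Nontrivial n] [Fintype c] [DecidableEq c] [Nonempty c] {Λ : SuperOp (n × n) (c × c)}
    (hΛ : IsSeparabilityPreserving Λ ∨ IsPPTPreserving Λ) {α : ℝ} (h0 : 0 ≤ α)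
    (h1 : α ≤ 1 - (Fintype.card n : ℝ)⁻¹) :
    (maxEnt c * Λ (isotropic n α)).trace.re ≤
      1 - α * (((Fintype.card n : ℝ) - Fintype.card n / Fintype.card c) /
        (Fintype.card n - 1)) := by
  have hch : IsChannel Λ := hΛ.elim And.left And.left
  have hD : (1 : ℝ) < Fintype.card n := by exact_mod_cast Fintype.one_lt_card
  have hd : (0 : ℝ) < Fintype.card c := by exact_mod_cast Fintype.card_pos
  have hinv : 0 < (Fintype.card n : ℝ)⁻¹ := by positivity
  have hsep := fidelity_le_of_separable hΛ
    (isotropic_mem_separableStates (n := n) le_rfl (by linarith))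
  have hmax : (maxEnt c * Λ (maxEnt n)).trace.re ≤ 1 := by
    have hs := hch.isState (maxEnt_isState (n := n))
    have h := re_trace_mul_nonneg (one_sub_maxEnt_posSemidef (n := c)) hs.1
    rw [Matrix.sub_mul, Matrix.one_mul, Matrix.trace_sub, hs.2, Complex.sub_re,
      Complex.one_re] at h
    linarith
  -- `t` solves α = t(1 - 1/D), so the state is a mixture of Φ and the separable state at the
  -- threshold. The fidelities of their images are at most 1 and 1/d respectively.
  set t := α * Fintype.card n / (Fintype.card n - 1) with ht
  have ht0 : 0 ≤ t := div_nonneg (by positivity) (by linarith)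
  have ht1 : t ≤ 1 := by
    rw [ht, div_le_one (by linarith)]
    have := mul_le_mul_of_nonneg_right h1 (by linarith : (0 : ℝ) ≤ Fintype.card n)
    rw [sub_mul, inv_mul_cancel₀ (by linarith)] at this
    linarith
  have hdec : isotropic n α =
      (1 - t) • maxEnt n + t • isotropic n (1 - (Fintype.card n : ℝ)⁻¹) := by
    have hne := (card_sq_sub_one_pos (n := n)).ne'
    have hne' : (Fintype.card n : ℝ) - 1 ≠ 0 := by linarith
    simp only [isotropic, ht]
    generalize (Fintype.card n : ℝ) = D at *
    match_scalars <;> field_simp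
    ring
  rw [hdec]
  simp only [← Complex.coe_smul, map_add, map_smul, Matrix.mul_add, Matrix.mul_smul,
    Matrix.trace_add, Matrix.trace_smul, Complex.add_re, smul_eq_mul, Complex.re_ofReal_mul]
  have e1 := mul_le_mul_of_nonneg_left hmax (sub_nonneg.mpr ht1)
  have e2 := mul_le_mul_of_nonneg_left hsep ht0
  refine (add_le_add e1 e2).trans (le_of_eq ?_)
  have hne' : (Fintype.card n : ℝ) - 1 ≠ 0 := by linarith
  rw [ht]
  field_simp
  ring

/-- The overhead of isotropic states for any class of operations that contains the preparations of
separable states and, in the entangled regime, an operation that attains the optimal fidelity. -/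
lemma overhead_isotropicState {k m : ℕ} (hm : 1 ≤ m) (hmk : m ≤ k) {α ε : ℝ}
    (hα₀ : 0 ≤ α) (hα₁ : α ≤ 1) (hε₀ : 0 ≤ ε)
    {O : Set (SuperOp (Qubits k × Qubits k) (Qubits m × Qubits m))}
    (hO : ∀ Λ ∈ O, IsSeparabilityPreserving Λ ∨ IsPPTPreserving Λ)
    (hprep : ∀ σ ∈ separableStates (Qubits m) (Qubits m), preparation σ ∈ O)
    (hopt : ∃ Λ ∈ O, Λ (isotropicState k α) =
      isotropicState m (α * ((2 ^ k - 2 ^ (k - m)) / (2 ^ k - 1)))) :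
    (1 - ((2 : ℝ) ^ k)⁻¹ ≤ α → overhead O ε (isotropicState k α) =
      ((max (2 ^ (m + 1) * (1 - ε) - 1) 1 : ℝ) : EReal)) ∧
    (α ≤ 1 - ((2 : ℝ) ^ k)⁻¹ → overhead O ε (isotropicState k α) =
      ((max (2 * (1 - ε) / (1 - α * ((2 ^ k - 2 ^ (k - m)) / (2 ^ k - 1))) - 1) 1 : ℝ) :
        EReal)) := by
  have : NeZero m := ⟨by omega⟩
  have : NeZero k := ⟨by omega⟩
  have hck : (Fintype.card (Qubits k) : ℝ) = 2 ^ k := by rw [card_qubits]; norm_num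
  have hcm : (Fintype.card (Qubits m) : ℝ) = 2 ^ m := by rw [card_qubits]; norm_num
  have hm1 : (1 : ℝ) ≤ 2 ^ m := one_le_pow₀ (by norm_num)
  have hk1 : (1 : ℝ) < 2 ^ k := one_lt_pow₀ (by norm_num) (by omega)
  have hinv : ((2 : ℝ) ^ m)⁻¹ ≤ 1 := inv_le_one_of_one_le₀ hm1
  have hpos : 0 < ((2 : ℝ) ^ m)⁻¹ := by positivity
  simp only [isotropicState_eq] at hopt ⊢
  have hρ : IsState (isotropic (Qubits k) α) := isotropic_isState hα₀ hα₁
  have hch : ∀ Λ ∈ O, IsChannel Λ := fun Λ h => (hO Λ h).elim And.left And.left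
  have hiso : ∀ β : ℝ, 1 - ((2 : ℝ) ^ m)⁻¹ ≤ β → β ≤ 1 →
      ∃ Λ ∈ O, Λ (isotropic (Qubits k) α) = isotropic (Qubits m) β := fun β h0 h1 =>
    -- Isotropic targets in the separable range are prepared outright, ignoring the input. This
    -- covers the fidelity-0 state needed for the negative part, and also the positive part when the
    -- input is separable.
    ⟨_, hprep _ (isotropic_mem_separableStates (by rwa [hcm]) h1), by
      rw [preparation_apply, hρ.2, one_smul]⟩
  constructor
  · intro h
    rw [overhead_eq_of_fidelity hε₀ hρ hpos hinv (fun Λ hΛ => ⟨hch Λ hΛ, ?_⟩)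
      (hiso _ le_rfl (by linarith)) (hiso 1 (by linarith) le_rfl)]
    · rw [div_inv_eq_mul, pow_succ]
      congr 3
      ring
    · rw [← hcm]
      exact fidelity_le_of_separable (hO Λ hΛ)
        (isotropic_mem_separableStates (by rwa [hck]) hα₁)
  · intro h
    have hdiv : (2 : ℝ) ^ (k - m) = 2 ^ k / 2 ^ m := by
      rw [pow_sub₀ _ two_ne_zero hmk, div_eq_mul_inv]
    set c : ℝ := (2 ^ k - 2 ^ (k - m)) / (2 ^ k - 1) with hc
    have hc0 : 0 ≤ c := div_nonneg
      (sub_nonneg.mpr (pow_le_pow_right₀ one_le_two (Nat.sub_le _ _))) (by linarith)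
    -- Multiplication by `c` carries the separability threshold for `k` to that for `m`; hence F = 1
    -- - αc ≥ 2^(-m) > 0 throughout this regime.
    have hc1 : (1 - ((2 : ℝ) ^ k)⁻¹) * c = 1 - ((2 : ℝ) ^ m)⁻¹ := by
      have : (2 : ℝ) ^ k - 1 ≠ 0 := by linarith
      rw [hc, hdiv]
      field_simp
    have hle := mul_le_mul_of_nonneg_right h hc0
    rw [hc1] at hle
    refine overhead_eq_of_fidelity hε₀ hρ (by linarith) (by linarith [mul_nonneg hα₀ hc0])
      (fun Λ hΛ => ⟨hch Λ hΛ, ?_⟩) (by rwa [sub_sub_cancel]) (hiso 1 (by linarith) le_rfl)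
    have := fidelity_isotropic_le (hO Λ hΛ) hα₀ (by rwa [hck])
    rwa [hck, hcm, ← hdiv] at this

lemma exists_isLOCC_isotropicState {k m : ℕ} (hm : 1 ≤ m) (hmk : m ≤ k) (α : ℝ) :
    ∃ Λ : SuperOp (Qubits k × Qubits k) (Qubits m × Qubits m), IsLOCC Λ ∧
      Λ (isotropicState k α) =
        isotropicState m (α * ((2 ^ k - 2 ^ (k - m)) / (2 ^ k - 1))) := by
  have : NeZero m := ⟨by omega⟩
  obtain ⟨r, rfl⟩ := Nat.exists_eq_add_of_le hmk
  have hinv : (0 : ℝ) < (Fintype.card (Qubits m) : ℝ)⁻¹ := by positivity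
  -- The first `m` qubits are kept and the remaining r = k - m measured. The fallback is the
  -- separable isotropic state of largest fidelity.
  refine ⟨collapse (Fin.appendEquiv m r) (isotropic _ (1 - (Fintype.card (Qubits m) : ℝ)⁻¹)),
    isLOCC_collapse _ (isotropic_mem_separableStates le_rfl (by linarith)), ?_⟩
  rw [isotropicState_eq, isotropicState_eq, collapse_isotropic, card_qubits, card_qubits,
    Nat.add_sub_cancel_left]
  push_cast
  rfl

/-- The case of equal input and output size, where the identity attains the optimal fidelity. -/
lemma overhead_isotropicState_self {k : ℕ} (hk : 1 ≤ k) {α ε : ℝ}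
    (hα₀ : 0 ≤ α) (hα₁ : α ≤ 1) (hε₀ : 0 ≤ ε)
    {O : Set (SuperOp (Qubits k × Qubits k) (Qubits k × Qubits k))}
    (hO : ∀ Λ ∈ O, IsSeparabilityPreserving Λ ∨ IsPPTPreserving Λ)
    (hprep : ∀ σ ∈ separableStates (Qubits k) (Qubits k), preparation σ ∈ O)
    (hid : LinearMap.id ∈ O) :
    (1 - ((2 : ℝ) ^ k)⁻¹ ≤ α → overhead O ε (isotropicState k α) =
      ((max (2 ^ (k + 1) * (1 - ε) - 1) 1 : ℝ) : EReal)) ∧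
    (α ≤ 1 - ((2 : ℝ) ^ k)⁻¹ → overhead O ε (isotropicState k α) =
      ((max ((1 + α - 2 * ε) / (1 - α)) 1 : ℝ) : EReal)) := by
  have hk1 : (1 : ℝ) < 2 ^ k := one_lt_pow₀ (by norm_num) (by omega)
  have hc : ((2 : ℝ) ^ k - 2 ^ (k - k)) / (2 ^ k - 1) = 1 := by
    rw [Nat.sub_self, pow_zero, div_self (by linarith)]
  have h := overhead_isotropicState hk le_rfl hα₀ hα₁ hε₀ hO hprep
    ⟨_, hid, by rw [hc, mul_one]; rfl⟩
  refine ⟨h.1, fun hα => ?_⟩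
  rw [h.2 hα, hc, mul_one]
  have hinv : 0 < ((2 : ℝ) ^ k)⁻¹ := by positivity
  have hne : 1 - α ≠ 0 := by linarith
  congr 2
  field_simp
  ring

end Overhead

section RandomLocalUnitary

lemma isRandomLocalUnitary_id {a b : Type} [Fintype a] [DecidableEq a] [Fintype b]
    [DecidableEq b] : IsRandomLocalUnitary (LinearMap.id : SuperOp (a × b) (a × b)) :=
  ⟨1, fun _ => 1, fun _ => 1, fun _ => 1, by simp, by simp, fun _ => one_mem _, fun _ => one_mem _,
    by simp [sandwich_one]⟩

end RandomLocalUnitary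

end VirtualDistillation

theorem mainTheorem11 (k : ℕ) (hk : 1 ≤ k) (α ε : ℝ)
    (hα₀ : 0 ≤ α) (hα₁ : α ≤ 1) (hε₀ : 0 ≤ ε) (hε₁ : ε ≤ 1) :
    -- general `m`, all sets of operations that include the separable operations
    (∀ m : ℕ, 1 ≤ m → m ≤ k →
      ∀ O : Set (VirtualDistillation.SuperOp
          (VirtualDistillation.Qubits k × VirtualDistillation.Qubits k)
          (VirtualDistillation.Qubits m × VirtualDistillation.Qubits m)),
        (∀ Λ ∈ O, VirtualDistillation.IsSeparabilityPreserving Λ ∨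
          VirtualDistillation.IsPPTPreserving Λ) →
        (∀ Λ, VirtualDistillation.IsSeparableOperation Λ → Λ ∈ O) →
        (1 - ((2 : ℝ) ^ k)⁻¹ ≤ α →
          VirtualDistillation.overhead O ε (VirtualDistillation.isotropicState k α) =
            ((max (2 ^ (m + 1) * (1 - ε) - 1) 1 : ℝ) : EReal)) ∧
        (α ≤ 1 - ((2 : ℝ) ^ k)⁻¹ →
          VirtualDistillation.overhead O ε (VirtualDistillation.isotropicState k α) =
            ((max (2 * (1 - ε) / (1 - α * ((2 ^ k - 2 ^ (k - m)) / (2 ^ k - 1))) - 1) 1 : ℝ) :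
              EReal))) ∧
    -- `m = k`, for the sets above and for all sets of operations that contain the local unitaries
    -- with shared randomness and the preparations of separable states
    (∀ O : Set (VirtualDistillation.SuperOp
          (VirtualDistillation.Qubits k × VirtualDistillation.Qubits k)
          (VirtualDistillation.Qubits k × VirtualDistillation.Qubits k)),
        (∀ Λ ∈ O, VirtualDistillation.IsSeparabilityPreserving Λ ∨
          VirtualDistillation.IsPPTPreserving Λ) →
        ((∀ Λ, VirtualDistillation.IsSeparableOperation Λ → Λ ∈ O) ∨
          ((∀ Λ, VirtualDistillation.IsRandomLocalUnitary Λ → Λ ∈ O) ∧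
            (∀ Λ, VirtualDistillation.IsSeparablePreparation Λ → Λ ∈ O))) →
        (1 - ((2 : ℝ) ^ k)⁻¹ ≤ α →
          VirtualDistillation.overhead O ε (VirtualDistillation.isotropicState k α) =
            ((max (2 ^ (k + 1) * (1 - ε) - 1) 1 : ℝ) : EReal)) ∧
        (α ≤ 1 - ((2 : ℝ) ^ k)⁻¹ →
          VirtualDistillation.overhead O ε (VirtualDistillation.isotropicState k α) =
            ((max ((1 + α - 2 * ε) / (1 - α)) 1 : ℝ) : EReal))) ∧
    -- `m = k`, LOCC
    ((1 - ((2 : ℝ) ^ k)⁻¹ ≤ α →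
        VirtualDistillation.overhead
            {Λ : VirtualDistillation.SuperOp
              (VirtualDistillation.Qubits k × VirtualDistillation.Qubits k)
              (VirtualDistillation.Qubits k × VirtualDistillation.Qubits k) |
              VirtualDistillation.IsLOCC Λ} ε (VirtualDistillation.isotropicState k α) =
          ((max (2 ^ (k + 1) * (1 - ε) - 1) 1 : ℝ) : EReal)) ∧
      (α ≤ 1 - ((2 : ℝ) ^ k)⁻¹ →
        VirtualDistillation.overhead
            {Λ : VirtualDistillation.SuperOp
              (VirtualDistillation.Qubits k × VirtualDistillation.Qubits k)
              (VirtualDistillation.Qubits k × VirtualDistillation.Qubits k) |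
              VirtualDistillation.IsLOCC Λ} ε (VirtualDistillation.isotropicState k α) =
          ((max ((1 + α - 2 * ε) / (1 - α)) 1 : ℝ) : EReal))) := by
  open VirtualDistillation in
  have hprep : ∀ {O : Set (SuperOp (Qubits k × Qubits k) (Qubits k × Qubits k))},
      (∀ Λ, IsLOCC Λ → Λ ∈ O) → (∀ σ ∈ separableStates (Qubits k) (Qubits k), preparation σ ∈ O) ∧
        LinearMap.id ∈ O :=
    fun h => ⟨fun _ hσ => h _ (isLOCC_preparation hσ), h _ IsLOCC.done⟩
  refine ⟨fun m hm hmk O hO hsep => ?_, fun O hO hcases => ?_, ?_⟩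
  · obtain ⟨Λ, hΛ, hopt⟩ := VirtualDistillation.exists_isLOCC_isotropicState hm hmk α
    exact VirtualDistillation.overhead_isotropicState hm hmk hα₀ hα₁ hε₀ hO
      (fun σ hσ => hsep _ (VirtualDistillation.isLOCC_preparation hσ).isSeparableOperation)
      ⟨Λ, hsep _ hΛ.isSeparableOperation, hopt⟩
  · rcases hcases with hsep | ⟨hU, hP⟩
    · have h := hprep fun Λ hΛ => hsep Λ hΛ.isSeparableOperation
      exact VirtualDistillation.overhead_isotropicState_self hk hα₀ hα₁ hε₀ hO h.1 h.2
    · exact VirtualDistillation.overhead_isotropicState_self hk hα₀ hα₁ hε₀ hO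
        (fun σ hσ => hP _ ⟨σ, hσ, fun _ => rfl⟩)
        (hU _ VirtualDistillation.isRandomLocalUnitary_id)
  · have h := hprep (O := {Λ | VirtualDistillation.IsLOCC Λ}) fun Λ hΛ => hΛ
    exact VirtualDistillation.overhead_isotropicState_self hk hα₀ hα₁ hε₀
      (fun Λ hΛ => Or.inl (VirtualDistillation.IsLOCC.isSeparableOperation hΛ).isSeparabilityPreserving)
      h.1 h.2
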